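/- For $n\in\mathbb N=\{0,1,2,\dots\}$ let $$L_n(x,z)=\sum_{i=0}^n \frac{(-1)^i\prod_{j=i+1}^n (z+j)}{i!\,(n-i)!}\,x^i$$ be the generalized Laguerre polynomial with parameter $z$, regarded as a polynomial in the two variables $x$ and $z$. Theorem. Let $n\in\mathbb N$. (1) For all $0\le k\le n$ and all real $z>-1$, $\partial_z^kL_n(x,z)$ is, as a polynomial in $x$, of degree exactly $n-k$, all its roots are real, and they are simple. (2) For $0\le k\le n$ and $z>-1$ let $x_1(z)>\dots>x_{n-k}(z)$ be the roots of $\partial_z^kL_n(\cdot,z)$. Each $x_i$ is differentiable with $\frac{d}{dz}x_i(z)>0$ on $(-1,\infty)$; in particular each $x_i$ is strictly increasing there. (3) For all $0\le k<n$ and $z>-1$, $\partial_z^{k+1}L_n(x,z)$ strictly interlaces $\partial_z^kL_n(x,z)$ in $x$: if $x_1>\dots>x_{n-k}$ are the roots of $\partial_z^kL_n(\cdot,z)$ and $y_1>\dots>y_{n-k-1}$ those of $\partial_z^{k+1}L_n(\cdot,z)$, then $x_1>y_1>x_2>y_2>\dots>y_{n-k-1}>x_{n-k}$. -/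

import Mathlib

open Polynomial

/-- The generalized Laguerre polynomial `L_n(x, z)` as a bivariate polynomial. The inner variable
is `x`, the outer variable is the parameter `z`:
`∑ i ≤ n, (-1)^i * (∏_{j = i+1}^{n} (z + j)) / (i! (n-i)!) * x^i`. -/
noncomputable def laguerre (n : ℕ) : ℝ[X][X] :=
  ∑ i ∈ Finset.range (n + 1),
    C (C ((-1 : ℝ) ^ i / ((i.factorial : ℝ) * ((n - i).factorial : ℝ))) * X ^ i) *
      ∏ j ∈ Finset.Icc (i + 1) n, (X + C (C (j : ℝ)))

/-- The polynomial `∂_z^k L_n(x, z)` in the variable `x`, for a fixed real value of `z`. -/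
noncomputable def laguerreDz (n k : ℕ) (z : ℝ) : ℝ[X] :=
  (derivative^[k] (laguerre n)).eval (C z)

/-- The value of `L_n` at `(x, z)`. -/
theorem eval_laguerreDz_zero (n : ℕ) (x z : ℝ) :
    (laguerreDz n 0 z).eval x = ∑ i ∈ Finset.range (n + 1),
      (-1 : ℝ) ^ i * (∏ j ∈ Finset.Icc (i + 1) n, (z + j)) /
        ((i.factorial : ℝ) * ((n - i).factorial : ℝ)) * x ^ i := by
  simp only [laguerreDz, laguerre, Function.iterate_zero, id_eq, eval_finsetSum, eval_mul,
    eval_C, eval_prod, eval_add, eval_X, eval_pow]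
  refine Finset.sum_congr rfl fun i _ => ?_
  ring

/-- `laguerreDz n k z` is the `k`-th partial derivative of `L_n` in `z`. -/
theorem eval_laguerreDz (n k : ℕ) (x z : ℝ) :
    (laguerreDz n k z).eval x = iteratedDeriv k (fun t => (laguerreDz n 0 t).eval x) z := by
  have key : ∀ (p : ℝ[X][X]) (t : ℝ), (p.eval (C t)).eval x = (p.map (evalRingHom x)).eval t := by
    intro p t
    have h := eval₂_hom (p := p) (evalRingHom x) (C t)
    simp only [coe_evalRingHom, eval_C] at h
    rw [← h, eval_map]
  simp only [laguerreDz, key, Function.iterate_zero, id_eq]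
  rw [← iterate_derivative_map]
  induction k generalizing z with
  | zero => simp
  | succ k ih =>
    rw [iteratedDeriv_succ, Function.iterate_succ_apply', ← Polynomial.deriv]
    congr 1
    funext t
    exact ih t

/-- `p` is a nonzero real polynomial of degree `m` all of whose roots are real, and
`a 0 ≥ a 1 ≥ ... ≥ a (m - 1)` are its roots, listed with multiplicity. -/
def HasOrderedRoots (p : ℝ[X]) {m : ℕ} (a : Fin m → ℝ) : Prop :=
  p ≠ 0 ∧ Antitone a ∧ p = C p.leadingCoeff * ∏ i, (X - C (a i))

/-- `p` of degree `m` has real roots `a 0 ≥ a 1 ≥ ...`, `q` of degree `m` or `m - 1` has real roots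
`b 0 ≥ b 1 ≥ ...`, and `a 0 > b 0 > a 1 > b 1 > ...`. -/
def StrictlyInterlacedFrom (p q : ℝ[X]) : Prop :=
  ∃ (m l : ℕ) (a : Fin m → ℝ) (b : Fin l → ℝ),
    (l = m ∨ l + 1 = m) ∧ HasOrderedRoots p a ∧ HasOrderedRoots q b ∧
    (∀ (i : Fin m) (j : Fin l), (i : ℕ) = j → b j < a i) ∧
    (∀ (i : Fin m) (j : Fin l), (i : ℕ) = j + 1 → a i < b j)

/-- `q`, of degree `deg p` or `deg p - 1`, strictly interlaces `p`; for equal degrees either of the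
two polynomials may have the largest root. -/
def StrictlyInterlaces (q p : ℝ[X]) : Prop :=
  StrictlyInterlacedFrom p q ∨ (p.natDegree = q.natDegree ∧ StrictlyInterlacedFrom q p)

open Filter Topology

/-! Exchange the variables. For fixed x > 0, L_n(x, z) is up to normalisation a Charlier polynomial
in y = z + n: it is the coefficient of t^n in exp(-xt)(1+t)^y, whose differential equation gives a
three-term recurrence in n (`charlierSeries_recurrence`). Hence it has n simple real roots in z, and
by Rolle ∂_z^k L_n has n - k. They form continuous curves r_i(x), strictly ordered over each x > 0.

Fix z > -1. Every curve lies below level z near x = 0 and above it for large x, so it crosses the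
level, and two curves never cross it at the same x. These n - k crossing points exhaust the roots of
a polynomial in x of degree n - k, so each curve crosses exactly once
(`IsParamRoots.exists_isLevelRoots`), which gives real, simple roots. A curve above level z is
therefore past its crossing; this turns order relations among heights (monotonicity in z, Rolle's
interlacing) into order relations among roots in x. Simplicity in both variables makes both partial
derivatives nonzero, so the implicit function theorem gives a nonzero derivative, whose sign is
fixed by monotonicity. -/

/-! ### Signs, simple roots and their continuity -/

theorem Polynomial.eventually_atTop_eval_pos {p : ℝ[X]} (hp : 0 < p.leadingCoeff) :
    ∀ᶠ x in atTop, 0 < p.eval x := by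
  rcases Nat.eq_zero_or_pos p.natDegree with h | h
  · rw [eq_C_of_natDegree_eq_zero h] at hp ⊢
    exact Eventually.of_forall fun x => by simpa using hp
  · exact (p.tendsto_atTop_of_leadingCoeff_nonneg (natDegree_pos_iff_degree_pos.1 h)
      hp.le).eventually_gt_atTop 0

theorem Polynomial.eventually_atBot_eval_pos {p : ℝ[X]} (hp : 0 < p.leadingCoeff) :
    ∀ᶠ x in atBot, 0 < (-1) ^ p.natDegree * p.eval x := by
  have h : 0 < (C ((-1) ^ p.natDegree) * p.comp (-X)).leadingCoeff := by
    rw [leadingCoeff_mul, leadingCoeff_C, leadingCoeff_comp (by simp), leadingCoeff_neg,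
      leadingCoeff_X, mul_left_comm, ← mul_pow]
    simpa using hp
  have h2 := tendsto_neg_atBot_atTop.eventually (eventually_atTop_eval_pos h)
  simpa using h2

/-- The counting argument used throughout: `m` distinct known roots leave no room for others or for
multiplicity. -/
theorem Polynomial.roots_eq_map_of_injective {p : ℝ[X]} {m : ℕ} (hm : p.natDegree = m)
    (hp : p ≠ 0) {a : Fin m → ℝ} (ha : Function.Injective a) (h : ∀ i, p.eval (a i) = 0) :
    p.roots = (Finset.univ.map ⟨a, ha⟩).val := by
  symm
  apply Multiset.eq_of_le_of_card_le
  · rw [Multiset.le_iff_subset (Finset.nodup _)]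
    intro x hx
    rw [Finset.mem_val, Finset.mem_map] at hx
    obtain ⟨i, -, rfl⟩ := hx
    rw [mem_roots hp]
    exact h i
  · simpa [hm] using p.card_roots'

theorem Polynomial.eq_prod_of_injective {p : ℝ[X]} {m : ℕ} (hm : p.natDegree = m)
    (hp : p ≠ 0) {a : Fin m → ℝ} (ha : Function.Injective a) (h : ∀ i, p.eval (a i) = 0) :
    p = C p.leadingCoeff * ∏ i, (X - C (a i)) := by
  have hr := roots_eq_map_of_injective hm hp ha h
  have := C_leadingCoeff_mul_prod_multiset_X_sub_C (p := p) (by rw [hr, hm]; simp)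
  rw [hr, Finset.map_val, Multiset.map_map] at this
  exact this.symm

theorem Polynomial.exists_eq_of_eval_eq_zero {p : ℝ[X]} {m : ℕ} (hm : p.natDegree = m)
    (hp : p ≠ 0) {a : Fin m → ℝ} (ha : Function.Injective a) (h : ∀ i, p.eval (a i) = 0)
    {x : ℝ} (hx : p.eval x = 0) : ∃ i, a i = x := by
  have : x ∈ p.roots := (mem_roots hp).2 hx
  rw [roots_eq_map_of_injective hm hp ha h] at this
  simpa using this

theorem Polynomial.strictMono_roots_unique {p : ℝ[X]} {m : ℕ} (hm : p.natDegree = m)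
    (hp : p ≠ 0) {a b : Fin m → ℝ} (ha : StrictMono a) (hb : StrictMono b)
    (ha0 : ∀ i, p.eval (a i) = 0) (hb0 : ∀ i, p.eval (b i) = 0) : a = b := by
  rw [← ha.range_inj hb]
  have : ∀ {c : Fin m → ℝ}, StrictMono c → (∀ i, p.eval (c i) = 0) →
      Set.range c = {x | p.eval x = 0} := fun hc hc0 =>
    Set.Subset.antisymm (by rintro _ ⟨i, rfl⟩; exact hc0 i)
      fun x hx => exists_eq_of_eval_eq_zero hm hp hc.injective hc0 hx
  rw [this ha ha0, this hb hb0]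

theorem Polynomial.derivative_eval_ne_zero_of_injective {p : ℝ[X]} {m : ℕ} (hm : p.natDegree = m)
    (hp : p ≠ 0) {a : Fin m → ℝ} (ha : Function.Injective a) (h : ∀ i, p.eval (a i) = 0)
    (i : Fin m) : p.derivative.eval (a i) ≠ 0 := by
  have hn : p.roots.Nodup := by
    rw [roots_eq_map_of_injective hm hp ha h]
    exact Finset.nodup _
  intro h0
  have := one_lt_rootMultiplicity_iff_isRoot hp |>.2 ⟨h i, h0⟩
  rw [← count_roots] at this
  exact absurd (Multiset.nodup_iff_count_le_one.1 hn (a i)) (by omega)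

/-- A root where the derivative does not vanish is enclosed by points where the signs differ. -/
theorem Polynomial.exists_eval_mul_eval_neg {p : ℝ[X]} {a : ℝ} (h : p.eval a = 0)
    (h' : p.derivative.eval a ≠ 0) {ε : ℝ} (hε : 0 < ε) :
    ∃ δ, 0 < δ ∧ δ < ε ∧ p.eval (a - δ) * p.eval (a + δ) < 0 := by
  obtain ⟨q, rfl⟩ : X - C a ∣ p := dvd_iff_isRoot.2 h
  have hq : q.eval a ≠ 0 := by simpa [derivative_mul] using h'
  have hpos : 0 < q.eval (a - 0) * q.eval (a + 0) := by
    simpa using mul_self_pos.2 hq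
  have hc : Continuous fun δ : ℝ => q.eval (a - δ) * q.eval (a + δ) := by fun_prop
  have h1 : ∀ᶠ δ in 𝓝[>] (0 : ℝ), 0 < q.eval (a - δ) * q.eval (a + δ) :=
    nhdsWithin_le_nhds (hc.continuousAt.eventually_const_lt hpos)
  obtain ⟨δ, hδ, h0, h2⟩ := (h1.and (Ioo_mem_nhdsGT hε)).exists
  refine ⟨δ, h0, h2, ?_⟩
  simp only [eval_mul, eval_sub, eval_X, eval_C]
  -- With p = (X - a) q the product is -δ² q(a - δ) q(a + δ), and q does not vanish at a.
  nlinarith [mul_pos hδ (mul_pos h0 h0)]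

theorem exists_mem_Ioo_eq_zero_of_mul_neg {f : ℝ → ℝ} (hf : Continuous f) {u v : ℝ} (huv : u < v)
    (h : f u * f v < 0) : ∃ t, u < t ∧ t < v ∧ f t = 0 := by
  rcases mul_neg_iff.1 h with ⟨hu, hv⟩ | ⟨hu, hv⟩
  · obtain ⟨t, ht, h0⟩ := intermediate_value_Ioo' huv.le hf.continuousOn ⟨hv, hu⟩
    exact ⟨t, ht.1, ht.2, h0⟩
  · obtain ⟨t, ht, h0⟩ := intermediate_value_Ioo huv.le hf.continuousOn ⟨hu, hv⟩
    exact ⟨t, ht.1, ht.2, h0⟩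

/-- The ordered simple roots of a continuous family of real-rooted polynomials are continuous. -/
theorem continuousAt_strictMono_roots {F : ℝ → ℝ[X]} {m : ℕ} {r : Fin m → ℝ → ℝ} {x₀ : ℝ}
    (hF : ∀ t, Continuous fun x => (F x).eval t)
    (h : ∀ᶠ x in 𝓝 x₀, (F x).natDegree = m ∧ F x ≠ 0 ∧ StrictMono (fun i => r i x) ∧
      ∀ i, (F x).eval (r i x) = 0) (i : Fin m) : ContinuousAt (r i) x₀ := by
  obtain ⟨hm, hne, hmono, hroot⟩ := h.self_of_nhds
  -- Intervals of radius below η around the roots are disjoint and ordered, so roots found in them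
  -- form an increasing list, which must be the given one.
  obtain ⟨η, hη, hgap⟩ : ∃ η > 0, ∀ i j : Fin m, i < j → r i x₀ + η < r j x₀ - η := by
    have : ∀ᶠ η in 𝓝[>] (0 : ℝ), ∀ i j : Fin m, i < j → r i x₀ + η < r j x₀ - η := by
      refine nhdsWithin_le_nhds ?_
      refine eventually_all.2 fun i => eventually_all.2 fun j => eventually_imp_distrib_left.2 ?_
      intro hij
      have hc : Continuous fun η : ℝ => (r j x₀ - η) - (r i x₀ + η) := by fun_prop
      have h0 : 0 < (r j x₀ - 0) - (r i x₀ + 0) := by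
        have := hmono hij
        simp only at this
        linarith
      filter_upwards [hc.continuousAt.eventually_const_lt h0] with η hη
      linarith
    obtain ⟨η, h1, h2⟩ := (this.and self_mem_nhdsWithin).exists
    exact ⟨η, h2, h1⟩
  rw [Metric.continuousAt_iff']
  intro ε hε
  choose δ hδ0 hδ hsign using fun i => exists_eval_mul_eval_neg (hroot i)
    (derivative_eval_ne_zero_of_injective hm hne hmono.injective hroot i) (lt_min hε hη)
  have hev : ∀ᶠ x in 𝓝 x₀, ∀ i, (F x).eval (r i x₀ - δ i) * (F x).eval (r i x₀ + δ i) < 0 := by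
    rw [eventually_all]
    exact fun i => ((hF _).mul (hF _)).continuousAt.eventually_lt_const (hsign i)
  filter_upwards [h, hev] with x ⟨hxm, hxne, hxmono, hxroot⟩ hx
  choose b hb1 hb2 hb0 using fun i => exists_mem_Ioo_eq_zero_of_mul_neg (F x).continuous
    (by linarith [hδ0 i] : r i x₀ - δ i < r i x₀ + δ i) (hx i)
  have hδη := fun i => (hδ i).trans_le (min_le_right _ _)
  have hb : StrictMono b := fun i j hij => by
    linarith [hb2 i, hb1 j, hgap i j hij, hδη i, hδη j]
  have := congrFun (strictMono_roots_unique hxm hxne hxmono hb hxroot hb0) i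
  rw [this, Real.dist_eq, abs_lt]
  have := (hδ i).trans_le (min_le_left _ _)
  constructor <;> linarith [hb1 i, hb2 i]

/-! ### Interlacing: Rolle's theorem and three-term recurrences -/

/-- Rolle's theorem for the ordered simple roots. -/
theorem Polynomial.exists_strictMono_roots_derivative {p : ℝ[X]} {m l : ℕ} (hl : l + 1 = m)
    {a : Fin m → ℝ} (ha : StrictMono a) (h : ∀ i, p.eval (a i) = 0) :
    ∃ b : Fin l → ℝ, StrictMono b ∧ (∀ j, p.derivative.eval (b j) = 0) ∧
      (∀ (i : Fin m) (j : Fin l), (i : ℕ) = j → a i < b j) ∧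
      (∀ (i : Fin m) (j : Fin l), (i : ℕ) = j + 1 → b j < a i) := by
  subst hl
  have : ∀ j : Fin l, ∃ t, a j.castSucc < t ∧ t < a j.succ ∧ p.derivative.eval t = 0 := by
    intro j
    obtain ⟨t, ht, h0⟩ := exists_deriv_eq_zero (ha j.castSucc_lt_succ) p.continuous.continuousOn
      ((h _).trans (h _).symm)
    exact ⟨t, ht.1, ht.2, by simpa using h0⟩
  choose b hb1 hb2 hb0 using this
  refine ⟨b, fun i j hij => ?_, hb0, fun i j hij => ?_, fun i j hij => ?_⟩
  · exact (hb2 i).trans_le ((ha.monotone (by simpa [Fin.le_def] using hij)).trans (hb1 j).le)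
  · rw [show i = j.castSucc from Fin.ext hij]
    exact hb1 j
  · rw [show i = j.succ from Fin.ext hij]
    exact hb2 j

/-- Exactly the m - i factors with index at least i are negative. -/
theorem neg_one_pow_mul_prod_sub_pos {m i : ℕ} {a : Fin m → ℝ} {t : ℝ}
    (h1 : ∀ j : Fin m, (j : ℕ) < i → a j < t) (h2 : ∀ j : Fin m, i ≤ j → t < a j) :
    0 < (-1) ^ (m - i) * ∏ j, (t - a j) := by
  have hc : (-1 : ℝ) ^ (m - i) = ∏ j : Fin m, if (j : ℕ) < i then 1 else -1 := by
    rw [Finset.prod_ite, Finset.prod_const_one, one_mul, Finset.prod_const]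
    congr 1
    have h := Finset.card_filter_add_card_filter_not (s := (Finset.univ : Finset (Fin m)))
      (fun j : Fin m => (j : ℕ) < i)
    rw [Fin.card_filter_val_lt, Finset.card_univ, Fintype.card_fin] at h
    omega
  rw [hc, ← Finset.prod_mul_distrib]
  refine Finset.prod_pos fun j _ => ?_
  split_ifs with h
  · linarith [h1 j h]
  · linarith [h2 j (not_lt.1 h)]

/-- If the signs of `p` at the `m` simple roots of `q` alternate, then `p` has `m + 1` roots
separated by those of `q`. -/
theorem exists_roots_of_alternating {p q : ℝ[X]} {m : ℕ} (hp : p.natDegree = m + 1)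
    (hlp : 0 < p.leadingCoeff) (hq : q.natDegree = m) (hlq : 0 < q.leadingCoeff)
    {a : Fin m → ℝ} (ha : StrictMono a) (ha0 : ∀ i, q.eval (a i) = 0)
    (hs : ∀ i : Fin m, 0 < (-1) ^ (m - i) * p.eval (a i)) :
    ∃ b : Fin (m + 1) → ℝ, StrictMono b ∧ (∀ i, p.eval (b i) = 0) ∧
      ∀ i : Fin (m + 1), 0 < (-1) ^ (m - i) * q.eval (b i) := by
  -- The separating point 0 ensures `lo < hi` even when `m = 0`.
  obtain ⟨lo, hlo, hloa, hlo0⟩ : ∃ lo, 0 < (-1) ^ (m + 1) * p.eval lo ∧ (∀ i, lo < a i) ∧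
      lo < 0 := by
    have := eventually_atBot_eval_pos hlp
    rw [hp] at this
    exact (this.and ((eventually_all.2 fun i => eventually_lt_atBot (a i)).and
      (eventually_lt_atBot 0))).exists
  obtain ⟨hi, hhi, hhia, hhi0⟩ : ∃ hi, 0 < p.eval hi ∧ (∀ i, a i < hi) ∧ 0 < hi :=
    ((eventually_atTop_eval_pos hlp).and ((eventually_all.2 fun i =>
      eventually_gt_atTop (a i)).and (eventually_gt_atTop 0))).exists
  -- Root i is sought between u = a (i - 1), or `lo`, and v = a i, or `hi`, where `p` has signs
  -- (-1)^(m+1-i) and (-1)^(m-i).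
  have hlower : ∀ i : Fin (m + 1), ∃ u, 0 < (-1) ^ (m + 1 - i) * p.eval u ∧
      (∀ j : Fin m, (j : ℕ) < i → a j ≤ u) ∧ (∀ j : Fin m, (i : ℕ) ≤ j → u < a j) ∧ u < hi := by
    intro ⟨i, hi'⟩
    rcases i with _ | i
    · exact ⟨lo, hlo, by simp, fun j _ => hloa j, hlo0.trans hhi0⟩
    · have him : i < m := by omega
      refine ⟨a ⟨i, him⟩, ?_, fun j hj => ha.monotone ?_, fun j hj => ha ?_, hhia _⟩
      · have := hs ⟨i, him⟩
        rwa [show m + 1 - (i + 1) = m - i by omega]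
      · exact Fin.le_def.2 (Nat.lt_succ_iff.1 hj)
      · exact Fin.lt_def.2 hj
  have hroot : ∀ i : Fin (m + 1), ∃ t, p.eval t = 0 ∧ (∀ j : Fin m, (j : ℕ) < i → a j < t) ∧
      (∀ j : Fin m, (i : ℕ) ≤ j → t < a j) := by
    intro i
    obtain ⟨u, hu, hua, hua', huhi⟩ := hlower i
    obtain ⟨v, hv, hva, huv⟩ : ∃ v, 0 < (-1) ^ (m - i) * p.eval v ∧
        (∀ j : Fin m, (i : ℕ) ≤ j → v ≤ a j) ∧ u < v := by
      rcases Nat.lt_or_ge i m with h | h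
      · exact ⟨a ⟨i, h⟩, hs ⟨i, h⟩, fun j hj => ha.monotone (Fin.le_def.2 hj), hua' _ le_rfl⟩
      · refine ⟨hi, ?_, fun j hj => absurd j.2 (by omega), huhi⟩
        simpa [Nat.sub_eq_zero_of_le h] using hhi
    have hneg : p.eval u * p.eval v < 0 := by
      have h1 := mul_pos hu hv
      rw [show m + 1 - (i : ℕ) = m - i + 1 by omega, pow_succ] at h1
      have h2 : ((-1 : ℝ) ^ (m - (i : ℕ))) * (-1) ^ (m - (i : ℕ)) = 1 := by
        rw [← mul_pow]; simp
      have h3 : (-1 : ℝ) ^ (m - (i : ℕ)) * -1 * p.eval u * ((-1) ^ (m - (i : ℕ)) * p.eval v) =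
        -(((-1 : ℝ) ^ (m - (i : ℕ))) * (-1) ^ (m - (i : ℕ))) * (p.eval u * p.eval v) := by ring
      rw [h3, h2] at h1
      linarith
    obtain ⟨t, hut, htv, ht⟩ := exists_mem_Ioo_eq_zero_of_mul_neg p.continuous huv hneg
    exact ⟨t, ht, fun j hj => (hua j hj).trans_lt hut, fun j hj => htv.trans_le (hva j hj)⟩
  choose b hb0 hb1 hb2 using hroot
  refine ⟨b, fun i j hij => ?_, hb0, fun i => ?_⟩
  · have him : (i : ℕ) < m := by have := Fin.lt_def.1 hij; omega
    exact (hb2 i ⟨i, him⟩ le_rfl).trans (hb1 j ⟨i, him⟩ hij)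
  · have hq0 : q ≠ 0 := by rintro rfl; simp at hlq
    rw [eq_prod_of_injective hq hq0 ha.injective ha0, eval_mul, eval_C, eval_prod]
    have := mul_pos hlq (neg_one_pow_mul_prod_sub_pos (hb1 i) (hb2 i))
    simp only [eval_sub, eval_X, eval_C]
    rwa [mul_left_comm]

/-- Polynomials satisfying a three-term recurrence with positive coefficients have simple real
roots. -/
theorem exists_strictMono_roots_of_recurrence {p : ℕ → ℝ[X]} (hdeg : ∀ n, (p n).natDegree = n)
    (hlc : ∀ n, 0 < (p n).leadingCoeff) {α β γ : ℕ → ℝ} (hα : ∀ n, 0 < α n) (hγ : ∀ n, 0 < γ n)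
    (hrec : ∀ n y, α n * (p (n + 2)).eval y =
      (y - β n) * (p (n + 1)).eval y - γ n * (p n).eval y) (n : ℕ) :
    ∃ a : Fin n → ℝ, StrictMono a ∧ ∀ i, (p n).eval (a i) = 0 := by
  -- The sign clause encodes interlacing and is what the induction propagates.
  have key : ∀ n, ∃ a : Fin (n + 1) → ℝ, StrictMono a ∧ (∀ i, (p (n + 1)).eval (a i) = 0) ∧
      ∀ i : Fin (n + 1), 0 < (-1) ^ (n - i) * (p n).eval (a i) := by
    intro n
    induction n with
    | zero =>
      exact exists_roots_of_alternating (hdeg 1) (hlc 1) (hdeg 0) (hlc 0)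
        (a := Fin.elim0) (fun i => i.elim0)
        (fun i => i.elim0) (fun i => i.elim0)
    | succ n ih =>
      obtain ⟨a, ha, ha0, hs⟩ := ih
      refine exists_roots_of_alternating (hdeg _) (hlc _) (hdeg _) (hlc _) ha ha0 fun i => ?_
      -- At a root of p (n + 1) the middle term drops out, so p (n + 2) and p n have opposite signs.
      have h1 := hrec n (a i)
      rw [ha0, mul_zero, zero_sub] at h1
      refine (mul_pos_iff_of_pos_left (hα n)).1 ?_
      rw [mul_left_comm, h1, show n + 1 - (i : ℕ) = n - i + 1 by omega, pow_succ]
      have := mul_pos (hγ n) (hs i)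
      linarith
  rcases n with _ | n
  · exact ⟨Fin.elim0, fun i => i.elim0, fun i => i.elim0⟩
  · obtain ⟨a, ha, ha0, -⟩ := key n
    exact ⟨a, ha, ha0⟩

/-! ### Differentiating an implicit solution -/

/-- A continuous solution of an implicit equation with nonzero partial derivatives is differentiable
with nonzero derivative. -/
theorem exists_hasDerivAt_ne_zero_of_implicit {Φ : ℝ × ℝ → ℝ} (hΦ : ContDiff ℝ 1 Φ) {ρ : ℝ → ℝ}
    {z₀ A B : ℝ} (hA : HasDerivAt (fun z => Φ (z, ρ z₀)) A z₀)
    (hB : HasDerivAt (fun x => Φ (z₀, x)) B (ρ z₀)) (hA0 : A ≠ 0) (hB0 : B ≠ 0)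
    (hρ : ContinuousAt ρ z₀) (h : ∀ᶠ z in 𝓝 z₀, Φ (z, ρ z) = 0) :
    ∃ d, HasDerivAt ρ d z₀ ∧ d ≠ 0 := by
  set Φ' := fderiv ℝ Φ (z₀, ρ z₀) with hΦ'
  have hs : HasStrictFDerivAt Φ Φ' (z₀, ρ z₀) := hΦ.contDiffAt.hasStrictFDerivAt one_ne_zero
  have hA' : Φ' (1, 0) = A :=
    (hs.hasFDerivAt.comp_hasDerivAt z₀ ((hasDerivAt_id z₀).prodMk
      (hasDerivAt_const z₀ (ρ z₀)))).unique hA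
  have hB' : Φ' (0, 1) = B :=
    (hs.hasFDerivAt.comp_hasDerivAt (ρ z₀) ((hasDerivAt_const (ρ z₀) z₀).prodMk
      (hasDerivAt_id (ρ z₀)))).unique hB
  have hinv : (Φ' ∘L .inr ℝ ℝ ℝ).IsInvertible := by
    refine ⟨ContinuousLinearEquiv.unitsEquivAut ℝ (Units.mk0 B hB0), ?_⟩
    ext
    simp [hB']
  have hev := (continuousAt_id.prodMk hρ).tendsto.eventually
    (hs.eventually_apply_eq_iff_implicitFunctionOfProdDomain hinv)
  have heq : ρ =ᶠ[𝓝 z₀] hs.implicitFunctionOfProdDomain hinv := by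
    filter_upwards [hev, h] with z hz hz0
    exact (hz.1 (hz0.trans h.self_of_nhds.symm)).symm
  obtain ⟨d, hd⟩ : ∃ d, HasDerivAt ρ d z₀ :=
    ⟨_, (hs.hasStrictFDerivAt_implicitFunctionOfProdDomain hinv).hasFDerivAt.hasDerivAt
      |>.congr_of_eventuallyEq heq⟩
  refine ⟨d, hd, ?_⟩
  -- If d = 0, the chain rule applied to Φ(z, ρ z) = 0 gives A = 0.
  rintro rfl
  have h1 := hs.hasFDerivAt.comp_hasDerivAt z₀ ((hasDerivAt_id z₀).prodMk hd)
  have h2 : HasDerivAt (Φ ∘ fun z => (id z, ρ z)) 0 z₀ :=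
    (hasDerivAt_const z₀ 0).congr_of_eventuallyEq h
  exact hA0 (hA'.symm.trans (h1.unique h2))

/-! ### Coefficients and degrees in each variable -/

/-- The coefficient of `x ^ i` in `L_n(x, z)`, up to the factor `1 / (i! (n-i)!)` and the sign, as a
polynomial in `z`. -/
noncomputable def shiftedProd (n i : ℕ) : ℝ[X] := ∏ j ∈ Finset.Icc (i + 1) n, (X + C (j : ℝ))

/-- The polynomial `∂_z^k L_n(x, z)` in the variable `z`, for a fixed real value of `x`. -/
noncomputable def laguerreParam (n k : ℕ) (x : ℝ) : ℝ[X] :=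
  derivative^[k] ((laguerre n).map (evalRingHom x))

theorem eval_laguerreParam (n k : ℕ) (x z : ℝ) :
    (laguerreParam n k x).eval z = (laguerreDz n k z).eval x := by
  rw [laguerreParam, laguerreDz, iterate_derivative_map, eval_map]
  simpa using eval₂_hom (p := derivative^[k] (laguerre n)) (evalRingHom x) (C z)

theorem laguerreParam_succ (n k : ℕ) (x : ℝ) :
    laguerreParam n (k + 1) x = derivative (laguerreParam n k x) :=
  Function.iterate_succ_apply' _ _ _

theorem laguerre_eq_sum (n : ℕ) : laguerre n = ∑ i ∈ Finset.range (n + 1),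
    C (C ((-1 : ℝ) ^ i / ((i.factorial : ℝ) * ((n - i).factorial : ℝ))) * X ^ i) *
      (shiftedProd n i).map C := by
  simp [laguerre, shiftedProd, Polynomial.map_prod]

theorem laguerreDz_eq_sum (n k : ℕ) (z : ℝ) : laguerreDz n k z = ∑ i ∈ Finset.range (n + 1),
    C ((-1 : ℝ) ^ i / ((i.factorial : ℝ) * ((n - i).factorial : ℝ)) *
      (derivative^[k] (shiftedProd n i)).eval z) * X ^ i := by
  rw [laguerreDz, laguerre_eq_sum, iterate_derivative_sum, eval_finsetSum]
  refine Finset.sum_congr rfl fun i _ => ?_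
  rw [iterate_derivative_C_mul, iterate_derivative_map, eval_mul, eval_C, eval_map_apply, C_mul]
  ring

theorem coeff_laguerreDz (n k i : ℕ) (z : ℝ) (hi : i ≤ n) : (laguerreDz n k z).coeff i =
    (-1 : ℝ) ^ i / ((i.factorial : ℝ) * ((n - i).factorial : ℝ)) *
      (derivative^[k] (shiftedProd n i)).eval z := by
  simp only [laguerreDz_eq_sum, finsetSum_coeff, coeff_C_mul_X_pow]
  rw [Finset.sum_ite_eq, if_pos (by simpa [Nat.lt_succ_iff] using hi)]

theorem natDegree_shiftedProd (n i : ℕ) : (shiftedProd n i).natDegree = n - i := by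
  rw [shiftedProd, natDegree_prod_of_monic _ _ fun j _ => monic_X_add_C _]
  simp only [natDegree_X_add_C]
  simp

theorem monic_shiftedProd (n i : ℕ) : (shiftedProd n i).Monic :=
  monic_prod_of_monic _ _ fun _ _ => monic_X_add_C _

/-- The derivative is k! times a nonempty sum of subproducts of the factors z + j with j ≥ 1, all
positive for z > -1. -/
theorem eval_iterate_derivative_shiftedProd_pos {n i k : ℕ} (hk : k ≤ n - i) {z : ℝ} (hz : -1 < z) :
    0 < (derivative^[k] (shiftedProd n i)).eval z := by
  let e : ℕ ↪ ℝ := ⟨fun j => -(j : ℝ), fun a b h => by simpa using h⟩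
  have h1 : shiftedProd n i = ∏ a ∈ (Finset.Icc (i + 1) n).map e, (X - C a) := by
    rw [shiftedProd, Finset.prod_map]
    exact Finset.prod_congr rfl fun j _ => by
      rw [show e j = -(j : ℝ) from rfl, C_neg, sub_neg_eq_add]
  have hc : ((Finset.Icc (i + 1) n).map e).card = n - i := by simp
  rw [h1, iterate_derivative_prod_X_sub_C (hc ▸ hk), eval_mul, eval_natCast, eval_finsetSum]
  refine mul_pos (by exact_mod_cast k.factorial_pos) (Finset.sum_pos (fun T hT => ?_) ?_)
  · rw [eval_prod]
    refine Finset.prod_pos fun a ha => ?_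
    obtain ⟨j, hj, rfl⟩ := Finset.mem_map.1 ((Finset.mem_powersetCard.1 hT).1 ha)
    have : (1 : ℝ) ≤ j := by exact_mod_cast (Nat.le_add_left 1 i).trans (Finset.mem_Icc.1 hj).1
    rw [eval_sub, eval_X, eval_C, show e j = -(j : ℝ) from rfl]
    linarith
  · exact Finset.powersetCard_nonempty.2 (Nat.sub_le _ _)

theorem natDegree_laguerreDz_le (n k : ℕ) (z : ℝ) : (laguerreDz n k z).natDegree ≤ n - k := by
  rw [laguerreDz_eq_sum]
  refine natDegree_sum_le_of_forall_le _ _ fun i hi => ?_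
  rcases Nat.lt_or_ge (n - i) k with h | h
  · rw [iterate_derivative_eq_zero (by rwa [natDegree_shiftedProd])]
    simp
  · exact (natDegree_C_mul_X_pow_le _ _).trans (by have := Finset.mem_range.1 hi; omega)

theorem coeff_laguerreDz_pos {n k : ℕ} (hk : k ≤ n) {z : ℝ} (hz : -1 < z) :
    0 < (-1) ^ (n - k) * (laguerreDz n k z).coeff (n - k) := by
  rw [coeff_laguerreDz _ _ _ _ (Nat.sub_le _ _), ← mul_assoc, mul_div_assoc', ← mul_pow]
  have := eval_iterate_derivative_shiftedProd_pos (n := n) (i := n - k) (k := k) (by omega) hz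
  simp only [mul_neg, mul_one, neg_neg, one_pow]
  positivity

theorem natDegree_laguerreDz {n k : ℕ} (hk : k ≤ n) {z : ℝ} (hz : -1 < z) :
    (laguerreDz n k z).natDegree = n - k :=
  (natDegree_laguerreDz_le n k z).antisymm
    (le_natDegree_of_ne_zero (right_ne_zero_of_mul (coeff_laguerreDz_pos hk hz).ne'))

theorem laguerreDz_ne_zero {n k : ℕ} (hk : k ≤ n) {z : ℝ} (hz : -1 < z) : laguerreDz n k z ≠ 0 := by
  intro h
  simpa [h] using coeff_laguerreDz_pos hk hz

theorem eval_laguerreDz_eq_sum (n k : ℕ) (x z : ℝ) :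
    (laguerreDz n k z).eval x = ∑ i ∈ Finset.range (n + 1),
      (-1 : ℝ) ^ i / ((i.factorial : ℝ) * ((n - i).factorial : ℝ)) *
      (derivative^[k] (shiftedProd n i)).eval z * x ^ i := by
  simp [laguerreDz_eq_sum, eval_finsetSum]

theorem Polynomial.contDiff_eval {p : ℝ[X]} {m : WithTop ℕ∞} : ContDiff ℝ m fun x => p.eval x := by
  simpa using p.contDiff_aeval (𝕜 := ℝ) m

theorem contDiff_eval_laguerreDz (n k : ℕ) :
    ContDiff ℝ 1 fun v : ℝ × ℝ => (laguerreDz n k v.1).eval v.2 := by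
  simp only [eval_laguerreDz_eq_sum]
  refine ContDiff.sum fun i _ => ?_
  exact (contDiff_const.mul (contDiff_eval.comp contDiff_fst)).mul (contDiff_snd.pow i)

theorem laguerreParam_zero_eq_sum (n : ℕ) (x : ℝ) :
    laguerreParam n 0 x = ∑ i ∈ Finset.range (n + 1),
      C ((-1 : ℝ) ^ i / ((i.factorial : ℝ) * ((n - i).factorial : ℝ)) * x ^ i) *
        shiftedProd n i := by
  refine funext fun z => ?_
  rw [eval_laguerreParam, eval_laguerreDz_eq_sum, eval_finsetSum]
  refine Finset.sum_congr rfl fun i _ => ?_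
  simp only [Function.iterate_zero, id_eq, eval_mul, eval_C]
  ring

theorem natDegree_laguerreParam_zero_le (n : ℕ) (x : ℝ) : (laguerreParam n 0 x).natDegree ≤ n := by
  rw [laguerreParam_zero_eq_sum]
  refine natDegree_sum_le_of_forall_le _ _ fun i _ => (natDegree_C_mul_le _ _).trans ?_
  rw [natDegree_shiftedProd]
  exact Nat.sub_le _ _

theorem coeff_laguerreParam_zero (n : ℕ) (x : ℝ) :
    (laguerreParam n 0 x).coeff n = 1 / n.factorial := by
  rw [laguerreParam_zero_eq_sum, finsetSum_coeff, Finset.sum_eq_single 0]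
  · have h := monic_shiftedProd n 0
    rw [Monic, leadingCoeff, natDegree_shiftedProd, Nat.sub_zero] at h
    rw [coeff_C_mul, h]
    simp
  · intro i hi hi0
    have := Finset.mem_range.1 hi
    rw [coeff_C_mul, coeff_eq_zero_of_natDegree_lt, mul_zero]
    rw [natDegree_shiftedProd]
    omega
  · simp

theorem natDegree_laguerreParam_le (n k : ℕ) (x : ℝ) : (laguerreParam n k x).natDegree ≤ n - k :=
  (natDegree_iterate_derivative _ _).trans
    (Nat.sub_le_sub_right (natDegree_laguerreParam_zero_le n x) k)

theorem coeff_laguerreParam_pos {n k : ℕ} (hk : k ≤ n) (x : ℝ) :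
    0 < (laguerreParam n k x).coeff (n - k) := by
  have h := coeff_laguerreParam_zero n x
  rw [laguerreParam, Function.iterate_zero, id_eq] at h
  rw [laguerreParam, coeff_iterate_derivative, Nat.sub_add_cancel hk, h, nsmul_eq_mul]
  have : 0 < n.descFactorial k := Nat.descFactorial_pos.2 hk
  positivity

theorem natDegree_laguerreParam {n k : ℕ} (hk : k ≤ n) (x : ℝ) :
    (laguerreParam n k x).natDegree = n - k :=
  (natDegree_laguerreParam_le n k x).antisymm
    (le_natDegree_of_ne_zero (coeff_laguerreParam_pos hk x).ne')

theorem leadingCoeff_laguerreParam_pos {n k : ℕ} (hk : k ≤ n) (x : ℝ) :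
    0 < (laguerreParam n k x).leadingCoeff := by
  rw [leadingCoeff, natDegree_laguerreParam hk]
  exact coeff_laguerreParam_pos hk x

theorem laguerreParam_ne_zero {n k : ℕ} (hk : k ≤ n) (x : ℝ) : laguerreParam n k x ≠ 0 :=
  leadingCoeff_ne_zero.1 (leadingCoeff_laguerreParam_pos hk x).ne'

theorem eval_laguerreParam_self (n : ℕ) (x s t : ℝ) :
    (laguerreParam n n x).eval s = (laguerreParam n n x).eval t := by
  rw [eq_C_of_natDegree_le_zero ((natDegree_laguerreParam_le n n x).trans_eq (Nat.sub_self n)),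
    eval_C, eval_C]

/-! ### Position of the roots in `z` for small and large `x` -/

/-- Puts all roots in the variable z below the level for small x. By downward induction from the
constant top derivative, ∂_z^k L_n increases on [z, ∞), so its sign at z suffices; by continuity
this is read off at x = 0. -/
theorem eventually_nhdsGT_laguerreParam_pos (n : ℕ) {z : ℝ} (hz : -1 < z) (k : ℕ) (hk : k ≤ n) :
    ∀ᶠ x in 𝓝[>] (0 : ℝ), ∀ t, z ≤ t → 0 < (laguerreParam n k x).eval t := by
  have h0 : ∀ k ≤ n, ∀ᶠ x in 𝓝[>] (0 : ℝ), 0 < (laguerreParam n k x).eval z := by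
    intro k hk
    simp only [eval_laguerreParam]
    refine nhdsWithin_le_nhds ((laguerreDz n k z).continuous.continuousAt.eventually_const_lt ?_)
    change 0 < (laguerreDz n k z).eval 0
    rw [← coeff_zero_eq_eval_zero, coeff_laguerreDz _ _ _ _ (Nat.zero_le n)]
    have := eval_iterate_derivative_shiftedProd_pos (n := n) (i := 0) (k := k) hk hz
    positivity
  induction hk using Nat.decreasingInduction with
  | self =>
    filter_upwards [h0 n le_rfl] with x hx t _
    rwa [eval_laguerreParam_self n x t z]
  | of_succ k hk ih =>
    filter_upwards [h0 k hk.le, ih] with x hx hd t ht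
    have hm : MonotoneOn (fun t => (laguerreParam n k x).eval t) (Set.Ici z) := by
      refine monotoneOn_of_deriv_nonneg (convex_Ici z) (Polynomial.continuousOn _)
        (Polynomial.differentiableOn _) fun s hs => ?_
      rw [interior_Ici] at hs
      rw [Polynomial.deriv, ← laguerreParam_succ]
      exact (hd s hs.le).le
    exact hx.trans_le (hm Set.self_mem_Ici ht ht)

/-- The mirror argument on (-∞, z]: the sign at z for large x is that of the leading coefficient in
x. -/
theorem eventually_atTop_laguerreParam_pos (n : ℕ) {z : ℝ} (hz : -1 < z) (k : ℕ) (hk : k ≤ n) :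
    ∀ᶠ x in atTop, ∀ t, t ≤ z → 0 < (-1) ^ (n - k) * (laguerreParam n k x).eval t := by
  have h0 : ∀ k ≤ n, ∀ᶠ x in atTop, 0 < (-1) ^ (n - k) * (laguerreParam n k x).eval z := by
    intro k hk
    have h : 0 < (C ((-1) ^ (n - k)) * laguerreDz n k z).leadingCoeff := by
      rw [leadingCoeff_mul, leadingCoeff_C, leadingCoeff, natDegree_laguerreDz hk hz]
      exact coeff_laguerreDz_pos hk hz
    simpa [eval_laguerreParam] using eventually_atTop_eval_pos h
  induction hk using Nat.decreasingInduction with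
  | self =>
    filter_upwards [h0 n le_rfl] with x hx t _
    rwa [eval_laguerreParam_self n x t z]
  | of_succ k hk ih =>
    filter_upwards [h0 k hk.le, ih] with x hx hd t ht
    have hm : AntitoneOn (fun t => (C ((-1) ^ (n - k)) * laguerreParam n k x).eval t)
        (Set.Iic z) := by
      refine antitoneOn_of_deriv_nonpos (convex_Iic z) (Polynomial.continuousOn _)
        (Polynomial.differentiableOn _) fun s hs => ?_
      rw [interior_Iic] at hs
      rw [Polynomial.deriv, derivative_C_mul, ← laguerreParam_succ, eval_mul, eval_C,
        show n - k = n - (k + 1) + 1 by omega, pow_succ]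
      linarith [hd s hs.le]
    have := hm ht Set.self_mem_Iic ht
    simp only [eval_mul, eval_C] at this
    exact hx.trans_le this

/-! ### The Charlier generating function and its recurrence -/

theorem eval_shiftedProd_sub {n i : ℕ} (hi : i ≤ n) (y : ℝ) :
    (shiftedProd n i).eval (y - n) = ∏ l ∈ Finset.range (n - i), (y - l) := by
  rw [shiftedProd, eval_prod]
  refine Finset.prod_nbij' (fun j => n - j) (fun l => n - l) ?_ ?_ ?_ ?_ ?_
  · intro j hj
    have := Finset.mem_Icc.1 hj
    exact Finset.mem_range.2 (by omega)
  · intro l hl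
    have := Finset.mem_range.1 hl
    exact Finset.mem_Icc.2 (by omega)
  · intro j hj
    have := Finset.mem_Icc.1 hj
    omega
  · intro l hl
    have := Finset.mem_range.1 hl
    omega
  · intro j hj
    rw [Nat.cast_sub (Finset.mem_Icc.1 hj).2]
    simp
    ring

/-- The power series of `exp (-x t) * (1 + t) ^ y` in `t`. -/
noncomputable def charlierSeries (x y : ℝ) : PowerSeries ℝ :=
  PowerSeries.mk (fun i => (-x) ^ i / (i.factorial : ℝ)) *
    PowerSeries.mk fun j => (∏ l ∈ Finset.range j, (y - l)) / (j.factorial : ℝ)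

/-- The shift produces falling factorials of y, so one series independent of n serves every degree.
-/
theorem eval_laguerreParam_sub (n : ℕ) (x y : ℝ) :
    (laguerreParam n 0 x).eval (y - n) = PowerSeries.coeff n (charlierSeries x y) := by
  rw [charlierSeries, PowerSeries.coeff_mul, Finset.Nat.sum_antidiagonal_eq_sum_range_succ_mk,
    laguerreParam_zero_eq_sum, eval_finsetSum]
  refine Finset.sum_congr rfl fun i hi => ?_
  rw [eval_mul, eval_shiftedProd_sub (Nat.lt_succ_iff.1 (Finset.mem_range.1 hi)), eval_C,
    PowerSeries.coeff_mk, PowerSeries.coeff_mk, neg_pow x]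
  field_simp

/-- The logarithmic derivative of exp(-xt)(1+t)^y is -x + y/(1+t), here cleared of its denominator.
-/
theorem one_add_X_mul_derivative_charlierSeries (x y : ℝ) :
    (1 + PowerSeries.X) * PowerSeries.derivative ℝ (charlierSeries x y) =
      (PowerSeries.C (y - x) - PowerSeries.C x * PowerSeries.X) * charlierSeries x y := by
  rw [charlierSeries]
  set U : PowerSeries ℝ := PowerSeries.mk fun i => (-x) ^ i / (i.factorial : ℝ) with hU
  set B : PowerSeries ℝ :=
    PowerSeries.mk fun j => (∏ l ∈ Finset.range j, (y - l)) / (j.factorial : ℝ) with hB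
  have h1 : PowerSeries.derivative ℝ U = -PowerSeries.C x * U := by
    ext n
    rw [PowerSeries.coeff_derivative, ← map_neg, PowerSeries.coeff_C_mul, hU, PowerSeries.coeff_mk,
      PowerSeries.coeff_mk, Nat.factorial_succ, pow_succ]
    push_cast
    field_simp
  have hb : ∀ n : ℕ, PowerSeries.coeff (n + 1) B * (n + 1) = (y - n) * PowerSeries.coeff n B := by
    intro n
    rw [hB, PowerSeries.coeff_mk, PowerSeries.coeff_mk, Nat.factorial_succ, Finset.prod_range_succ]
    push_cast
    field_simp
  have h2 : (1 + PowerSeries.X) * PowerSeries.derivative ℝ B = PowerSeries.C y * B := by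
    ext n
    rw [add_mul, one_mul, map_add, PowerSeries.coeff_C_mul, PowerSeries.coeff_derivative, hb]
    rcases n with _ | n
    · simp
    · rw [PowerSeries.coeff_succ_X_mul, PowerSeries.coeff_derivative]
      push_cast
      ring
  rw [Derivation.leibniz, smul_eq_mul, smul_eq_mul, h1, mul_add, mul_left_comm, h2, map_sub]
  ring

/-- Compare coefficients of t^(n+1) in the differential equation. The last coefficient is x, so the
recurrence has the required sign exactly for x > 0. -/
theorem charlierSeries_recurrence (n : ℕ) (x y : ℝ) :
    (n + 2 : ℝ) * PowerSeries.coeff (n + 2) (charlierSeries x y) =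
      (y - (x + (n + 1))) * PowerSeries.coeff (n + 1) (charlierSeries x y) -
        x * PowerSeries.coeff n (charlierSeries x y) := by
  have h := congrArg (PowerSeries.coeff (n + 1)) (one_add_X_mul_derivative_charlierSeries x y)
  rw [add_mul, one_mul, map_add, PowerSeries.coeff_succ_X_mul, sub_mul, map_sub, mul_assoc,
    PowerSeries.coeff_C_mul, PowerSeries.coeff_C_mul, PowerSeries.coeff_succ_X_mul,
    PowerSeries.coeff_derivative, PowerSeries.coeff_derivative] at h
  push_cast at h
  linarith

theorem exists_roots_laguerreParam (n : ℕ) {x : ℝ} (hx : 0 < x) (k : ℕ) (hk : k ≤ n) :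
    ∃ a : Fin (n - k) → ℝ, StrictMono a ∧ ∀ i, (laguerreParam n k x).eval (a i) = 0 := by
  induction k with
  | zero =>
    obtain ⟨a, ha, h0⟩ := exists_strictMono_roots_of_recurrence
      (p := fun n => (laguerreParam n 0 x).comp (X - C (n : ℝ)))
      (fun n => by
        rw [natDegree_comp, natDegree_X_sub_C, natDegree_laguerreParam n.zero_le, mul_one,
          Nat.sub_zero])
      (fun n => by
        rw [leadingCoeff_comp (by simp only [natDegree_X_sub_C]; exact one_ne_zero),
          leadingCoeff_X_sub_C, one_pow, mul_one]
        exact leadingCoeff_laguerreParam_pos n.zero_le x)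
      (α := fun n => n + 2) (β := fun n => x + (n + 1)) (γ := fun _ => x)
      (fun n => by positivity) (fun _ => hx)
      (fun n y => by
        simp only [eval_comp, eval_sub, eval_X, eval_C, eval_laguerreParam_sub]
        exact charlierSeries_recurrence n x y) n
    refine ⟨fun i => a i - n, fun i j hij => sub_lt_sub_right (ha hij) _, fun i => ?_⟩
    simpa using h0 i
  | succ k ih =>
    obtain ⟨a, ha, h0⟩ := ih (by omega)
    obtain ⟨b, hb, hb0, -⟩ := exists_strictMono_roots_derivative
      (show n - (k + 1) + 1 = n - k by omega) ha h0
    exact ⟨b, hb, by rwa [laguerreParam_succ]⟩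

/-! ### Root curves and their crossings with a level -/

/-- `r` lists, in increasing order, the roots of `∂_z^k L_n(x, z)` in the variable `z`, as continuous
functions of `x > 0`. -/
structure IsParamRoots (n k : ℕ) (r : Fin (n - k) → ℝ → ℝ) : Prop where
  strictMono : ∀ x, 0 < x → StrictMono fun i => r i x
  eval_eq_zero : ∀ x, 0 < x → ∀ i, (laguerreParam n k x).eval (r i x) = 0
  continuousOn : ∀ i, ContinuousOn (r i) (Set.Ioi 0)

/-- `ρ` lists the roots of `∂_z^k L_n(x, z)` in the variable `x` for a fixed `z`, and `ρ i` is the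
only point where the curve `r i` meets the level `z`. -/
structure IsLevelRoots (n k : ℕ) (r : Fin (n - k) → ℝ → ℝ) (z : ℝ) (ρ : Fin (n - k) → ℝ) :
    Prop where
  pos : ∀ i, 0 < ρ i
  apply_eq : ∀ i, r i (ρ i) = z
  strictAnti : StrictAnti ρ
  eval_eq_zero : ∀ i, (laguerreDz n k z).eval (ρ i) = 0
  lt_of_lt : ∀ i x, 0 < x → z < r i x → ρ i < x

section

variable {n k : ℕ}

theorem exists_isParamRoots (hk : k ≤ n) : ∃ r, IsParamRoots n k r := by
  choose! a ha h0 using fun x (hx : (0 : ℝ) < x) => exists_roots_laguerreParam n hx k hk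
  refine ⟨fun i x => a x i, ha, h0, fun i x hx => ContinuousAt.continuousWithinAt ?_⟩
  refine continuousAt_strictMono_roots (F := laguerreParam n k) (r := fun i x => a x i)
    (fun t => ?_) ?_ i
  · simp only [eval_laguerreParam]
    exact Polynomial.continuous _
  · filter_upwards [Ioi_mem_nhds hx] with y hy
    exact ⟨natDegree_laguerreParam hk y, laguerreParam_ne_zero hk y, ha y hy, h0 y hy⟩

variable {r : Fin (n - k) → ℝ → ℝ}

theorem IsParamRoots.exists_lt_apply_eq (h : IsParamRoots n k r) (hk : k ≤ n) {z : ℝ} (hz : -1 < z)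
    {i : Fin (n - k)} {x : ℝ} (hx : 0 < x) (hzx : z < r i x) :
    ∃ y, 0 < y ∧ y < x ∧ r i y = z := by
  obtain ⟨u, hu, hu0, hux⟩ :=
    ((eventually_nhdsGT_laguerreParam_pos n hz k hk).and (Ioo_mem_nhdsGT hx)).exists
  have huz : r i u < z := by
    by_contra! hc
    exact (hu _ hc).ne' (h.eval_eq_zero u hu0 i)
  obtain ⟨y, hy, hyz⟩ := intermediate_value_Ioo hux.le
    ((h.continuousOn i).mono fun t ht => hu0.trans_le ht.1) ⟨huz, hzx⟩
  exact ⟨y, hu0.trans hy.1, hy.2, hyz⟩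

theorem IsParamRoots.exists_gt_apply_eq (h : IsParamRoots n k r) (hk : k ≤ n) {z : ℝ} (hz : -1 < z)
    {i : Fin (n - k)} {x : ℝ} (hx : 0 < x) (hzx : r i x < z) : ∃ y, x < y ∧ r i y = z := by
  obtain ⟨u, hu, hxu⟩ :=
    ((eventually_atTop_laguerreParam_pos n hz k hk).and (eventually_gt_atTop x)).exists
  have huz : z < r i u := by
    by_contra! hc
    exact (right_ne_zero_of_mul (hu _ hc).ne') (h.eval_eq_zero u (hx.trans hxu) i)
  obtain ⟨y, hy, hyz⟩ := intermediate_value_Ioo hxu.le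
    ((h.continuousOn i).mono fun t ht => hx.trans_le ht.1) ⟨hzx, huz⟩
  exact ⟨y, hy.1, hyz⟩

/-- Existence of crossings comes from the intermediate value theorem, their uniqueness from counting
roots in x. -/
theorem IsParamRoots.exists_isLevelRoots (h : IsParamRoots n k r) (hk : k ≤ n) {z : ℝ}
    (hz : -1 < z) : ∃ ρ, IsLevelRoots n k r z ρ := by
  have hex : ∀ i, ∃ x, 0 < x ∧ r i x = z := by
    intro i
    rcases lt_trichotomy (r i 1) z with h1 | h1 | h1
    · obtain ⟨y, hy, hyz⟩ := h.exists_gt_apply_eq hk hz one_pos h1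
      exact ⟨y, one_pos.trans hy, hyz⟩
    · exact ⟨1, one_pos, h1⟩
    · obtain ⟨y, hy, -, hyz⟩ := h.exists_lt_apply_eq hk hz one_pos h1
      exact ⟨y, hy, hyz⟩
  choose ρ hpos hρ using hex
  have hroot : ∀ i x, 0 < x → r i x = z → (laguerreDz n k z).eval x = 0 := by
    intro i x hx hi
    rw [← eval_laguerreParam, ← hi]
    exact h.eval_eq_zero x hx i
  have hinj : Function.Injective ρ := fun i j hij =>
    (h.strictMono _ (hpos i)).injective ((hρ i).trans (by simp only [hij, hρ]))
  -- Any crossing of curve i is some ρ j by counting; there curves i and j have equal height, so i =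
  -- j.
  have huniq : ∀ i x, 0 < x → r i x = z → x = ρ i := by
    intro i x hx hi
    obtain ⟨j, rfl⟩ := exists_eq_of_eval_eq_zero (natDegree_laguerreDz hk hz)
      (laguerreDz_ne_zero hk hz) hinj (fun i => hroot i _ (hpos i) (hρ i)) (hroot i x hx hi)
    rw [(h.strictMono _ hx).injective (hi.trans (hρ j).symm)]
  have hlt : ∀ i x, 0 < x → z < r i x → ρ i < x := by
    intro i x hx hi
    obtain ⟨y, hy, hyx, hyz⟩ := h.exists_lt_apply_eq hk hz hx hi
    rwa [← huniq i y hy hyz]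
  -- For i < j, curve j is above level z at ρ i, hence already past its own crossing.
  refine ⟨ρ, hpos, hρ, fun i j hij => hlt j _ (hpos i) ?_, fun i => hroot i _ (hpos i) (hρ i), hlt⟩
  have := h.strictMono _ (hpos i) hij
  simp only [hρ] at this
  exact this

theorem IsLevelRoots.roots_eq {z : ℝ} {ρ : Fin (n - k) → ℝ} (h : IsLevelRoots n k r z ρ)
    (hk : k ≤ n) (hz : -1 < z) :
    (laguerreDz n k z).roots = (Finset.univ.map ⟨ρ, h.strictAnti.injective⟩).val :=
  roots_eq_map_of_injective (natDegree_laguerreDz hk hz) (laguerreDz_ne_zero hk hz)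
    h.strictAnti.injective h.eval_eq_zero

theorem IsLevelRoots.hasOrderedRoots {z : ℝ} {ρ : Fin (n - k) → ℝ} (h : IsLevelRoots n k r z ρ)
    (hk : k ≤ n) (hz : -1 < z) : HasOrderedRoots (laguerreDz n k z) ρ :=
  ⟨laguerreDz_ne_zero hk hz, h.strictAnti.antitone, eq_prod_of_injective
    (natDegree_laguerreDz hk hz) (laguerreDz_ne_zero hk hz) h.strictAnti.injective h.eval_eq_zero⟩

theorem IsParamRoots.continuousAt_levelRoots {ρ : ℝ → Fin (n - k) → ℝ} (hk : k ≤ n)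
    (hρ : ∀ z, -1 < z → IsLevelRoots n k r z (ρ z)) {z : ℝ} (hz : -1 < z) (i : Fin (n - k)) :
    ContinuousAt (fun z => ρ z i) z := by
  have := continuousAt_strictMono_roots (F := laguerreDz n k) (r := fun i z => ρ z i.rev) (x₀ := z)
    (fun t => (contDiff_eval_laguerreDz n k).continuous.comp (by fun_prop : Continuous fun z => (z, t)))
    ?_ i.rev
  · simpa using this
  · filter_upwards [Ioi_mem_nhds hz] with w hw
    exact ⟨natDegree_laguerreDz hk hw, laguerreDz_ne_zero hk hw,
      fun i j hij => (hρ w hw).strictAnti (Fin.rev_lt_rev.2 hij), fun i => (hρ w hw).eval_eq_zero _⟩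

/-- At ρ w i the curve has height w > z, so it is past its crossing with level z. -/
theorem IsParamRoots.strictMonoOn_levelRoots {ρ : ℝ → Fin (n - k) → ℝ}
    (hρ : ∀ z, -1 < z → IsLevelRoots n k r z (ρ z)) (i : Fin (n - k)) :
    StrictMonoOn (fun z => ρ z i) (Set.Ioi (-1)) := fun z hz w hw hzw =>
  (hρ z hz).lt_of_lt i _ ((hρ w hw).pos i) (by rwa [(hρ w hw).apply_eq])

/-- The point (z, ρ z i) is a simple root in each variable separately, so the implicit function
argument applies. -/
theorem IsParamRoots.exists_hasDerivAt_levelRoots (h : IsParamRoots n k r)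
    {ρ : ℝ → Fin (n - k) → ℝ} (hk : k ≤ n)
    (hρ : ∀ z, -1 < z → IsLevelRoots n k r z (ρ z)) {z : ℝ} (hz : -1 < z) (i : Fin (n - k)) :
    ∃ d, HasDerivAt (fun z => ρ z i) d z ∧ 0 < d := by
  have hx := (hρ z hz).pos i
  have hA := derivative_eval_ne_zero_of_injective (natDegree_laguerreParam hk (ρ z i))
    (laguerreParam_ne_zero hk _) (h.strictMono _ hx).injective (h.eval_eq_zero _ hx) i
  rw [(hρ z hz).apply_eq] at hA
  have hB := derivative_eval_ne_zero_of_injective (natDegree_laguerreDz hk hz)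
    (laguerreDz_ne_zero hk hz) (hρ z hz).strictAnti.injective (hρ z hz).eval_eq_zero i
  obtain ⟨d, hd, hd0⟩ := exists_hasDerivAt_ne_zero_of_implicit (contDiff_eval_laguerreDz n k)
    (ρ := fun z => ρ z i) (z₀ := z)
    (by simpa only [eval_laguerreParam] using (laguerreParam n k (ρ z i)).hasDerivAt z)
    ((laguerreDz n k z).hasDerivAt (ρ z i)) hA hB (continuousAt_levelRoots hk hρ hz i)
    (by
      filter_upwards [Ioi_mem_nhds hz] with w hw
      exact (hρ w hw).eval_eq_zero i)
  refine ⟨d, hd, lt_of_le_of_ne ?_ hd0.symm⟩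
  rw [← (hd.hasDerivWithinAt (s := Set.Ioi (-1))).derivWithin
    (isOpen_Ioi.uniqueDiffWithinAt hz)]
  exact (strictMonoOn_levelRoots hρ i).monotoneOn.derivWithin_nonneg

end

/-! ### Interlacing in `x` and the main theorem -/

/-- Over each x > 0 Rolle interlaces the curves `r` and `s`. At a crossing of one curve with level
z, a higher neighbour is above z and so has crossed at a smaller x. -/
theorem strictlyInterlaces_laguerreDz_succ {n k : ℕ} (hk : k < n) {z : ℝ} (hz : -1 < z) :
    StrictlyInterlaces (laguerreDz n (k + 1) z) (laguerreDz n k z) := by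
  obtain ⟨r, hr⟩ := exists_isParamRoots hk.le
  obtain ⟨s, hs⟩ := exists_isParamRoots (Nat.succ_le_of_lt hk)
  obtain ⟨ρ, hρ⟩ := hr.exists_isLevelRoots hk.le hz
  obtain ⟨σ, hσ⟩ := hs.exists_isLevelRoots (Nat.succ_le_of_lt hk) hz
  have hrs : ∀ x, 0 < x →
      (∀ (i : Fin (n - k)) (j : Fin (n - (k + 1))), (i : ℕ) = j → r i x < s j x) ∧
      (∀ (i : Fin (n - k)) (j : Fin (n - (k + 1))), (i : ℕ) = j + 1 → s j x < r i x) := by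
    intro x hx
    obtain ⟨b, hb, hb0, hlt⟩ := exists_strictMono_roots_derivative
      (show n - (k + 1) + 1 = n - k by omega) (hr.strictMono x hx) (hr.eval_eq_zero x hx)
    rw [← laguerreParam_succ] at hb0
    obtain rfl := strictMono_roots_unique (natDegree_laguerreParam hk x)
      (laguerreParam_ne_zero hk x) hb (hs.strictMono x hx) hb0 (hs.eval_eq_zero x hx)
    exact hlt
  refine Or.inl ⟨n - k, n - (k + 1), ρ, σ, Or.inr (by omega), hρ.hasOrderedRoots hk.le hz,
    hσ.hasOrderedRoots hk hz, fun i j hij => ?_, fun i j hij => ?_⟩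
  · refine hσ.lt_of_lt j _ (hρ.pos i) ?_
    have := (hrs _ (hρ.pos i)).1 i j hij
    rwa [hρ.apply_eq] at this
  · refine hρ.lt_of_lt i _ (hσ.pos j) ?_
    have := (hrs _ (hσ.pos j)).2 i j hij
    rwa [hσ.apply_eq] at this

theorem mainTheorem5 (n : ℕ) :
    -- degree `n - k`, real-rootedness and simplicity of the roots
    (∀ k : ℕ, k ≤ n → ∀ z : ℝ, -1 < z →
      (laguerreDz n k z).degree = ((n - k : ℕ) : WithBot ℕ) ∧
      (laguerreDz n k z).Splits ∧ (laguerreDz n k z).roots.Nodup) ∧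
    -- the ordered roots are increasing functions of `z`, with positive derivative
    (∀ k : ℕ, k ≤ n → ∃ r : Fin (n - k) → ℝ → ℝ,
      (∀ z : ℝ, -1 < z → HasOrderedRoots (laguerreDz n k z) (fun i => r i z)) ∧
      (∀ i, StrictMonoOn (r i) (Set.Ioi (-1))) ∧
      (∀ i, ∀ z : ℝ, -1 < z → ∃ d : ℝ, HasDerivAt (r i) d z ∧ 0 < d)) ∧
    -- consecutive derivatives interlace strictly
    (∀ k : ℕ, k < n → ∀ z : ℝ, -1 < z →
      StrictlyInterlaces (laguerreDz n (k + 1) z) (laguerreDz n k z)) := by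
  refine ⟨fun k hk z hz => ?_, fun k hk => ?_, fun k hk z hz =>
    strictlyInterlaces_laguerreDz_succ hk hz⟩
  · obtain ⟨r, hr⟩ := exists_isParamRoots hk
    obtain ⟨ρ, hρ⟩ := hr.exists_isLevelRoots hk hz
    have hroots := hρ.roots_eq hk hz
    refine ⟨?_, ?_, ?_⟩
    · rw [degree_eq_natDegree (laguerreDz_ne_zero hk hz), natDegree_laguerreDz hk hz]
    · rw [splits_iff_card_roots, hroots, natDegree_laguerreDz hk hz]
      simp
    · rw [hroots]
      exact Finset.nodup _
  · obtain ⟨r, hr⟩ := exists_isParamRoots hk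
    choose! ρ hρ using fun z (hz : -1 < z) => hr.exists_isLevelRoots hk hz
    exact ⟨fun i z => ρ z i, fun z hz => (hρ z hz).hasOrderedRoots hk hz,
      IsParamRoots.strictMonoOn_levelRoots hρ,
      fun i z hz => hr.exists_hasDerivAt_levelRoots hk hρ hz i⟩
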